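/- Let $p\ge 1$ and $a_0,\dots,a_p\in\mathbb C$ with $a_p\neq 0$. Define monic polynomials $(Q_n)$ by $Q_0=1$, $Q_n=0$ for $n<0$, and $$\lambda Q_n(\lambda)=Q_{n+1}(\lambda)+a_0Q_n(\lambda)+\cdots+a_pQ_{n-p}(\lambda),\qquad n\ge 0.$$ Let $A$ be the bounded operator on $\ell^2=\ell^2(\{0,1,2,\dots\})$ given by the infinite Toeplitz matrix with $1$ on the first superdiagonal, $a_k$ on the $k$-th subdiagonal ($0\le k\le p$, $k=0$ being the main diagonal) and $0$ elsewhere. Let $\mathbf e_0,\mathbf e_1,\dots$ be the standard unit vectors of $\ell^2$ and $(\cdot,\cdot)$ its standard inner product, linear in the first argument. For $1\le j\le p$ put $$g_j(\lambda)=\big((\lambda I-A)^{-1}\mathbf e_{j-1},\mathbf e_0\big)\quad\text{for $\lambda$ outside the spectrum of $A$},$$ and let $L_j$ be the linear functional on polynomials with $L_j(\lambda^k)=(A^k(\mathbf e_0+\cdots+\mathbf e_{j-1}),\mathbf e_0)$ for $k\ge0$. For $\lambda\in\mathbb C$ let $z_0(\lambda),\dots,z_p(\lambda)$ be the $p+1$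 solutions, counted with multiplicity, of $$a(z)=\frac1z+a_0+a_1z+\cdots+a_pz^p=\lambda,$$ labelled so that $|z_0(\lambda)|\le\cdots\le|z_p(\lambda)|$ (ties broken arbitrarily), and let $\Gamma_1=\{\lambda\in\mathbb C:|z_0(\lambda)|=|z_1(\lambda)|\}$. For $n=mp+k$ with $m\ge0$ and $0\le k\le p-1$, let $\mathbf n=(n_1,\dots,n_p)$ be the staircase multi-index with $n_j=m+1$ for $1\le j\le k$ and $n_j=m$ for $k<j\le p$; thus $n_1+\cdots+n_p=n$. Then: i) $(g_1(\lambda),\dots,g_p(\lambda))=(z_0(\lambda),\dots,z_0(\lambda)^p)$ for every $\lambda$ outside the spectrum of $A$; in particular, for each $j=1,\dots,p$ the functions $g_j$ and $z_0^j$ have the same convergent Laurent expansion $\sum_{m\ge0}c_{j,m}\lambda^{-m-1}$ in a neighbourhood of $\infty$. ii) For all $n\ge0$ and $1\le j\le p$, $L_j(\lambda^kQ_n(\lambda))=0$ for $k=0,\dots,n_j-1$. iii) For all $n\ge0$, $\left(\frac{Q_{n-1}}{Q_n},\dots,\frac{Q_{n-p}}{Q_n}\right)$ is a type II Hermite–Padé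 approximant to $(z_0,\dots,z_0^p)$ at $\infty$ with respect to $\mathbf n$: $Q_n$ is a nonzero polynomial of degree at most $n_1+\cdots+n_p$, and for $j=1,\dots,p$ $$Q_n(\lambda)z_0(\lambda)^j-Q_{n-j}(\lambda)=\mathcal O\!\left(\frac1{\lambda^{n_j+1}}\right),\qquad\lambda\to\infty.$$ iv) For each $j=1,\dots,p$, $z_0^j$ and all the quotients $Q_{n-j}/Q_n$ tend to $0$ as $\lambda\to\infty$; extend them to $\infty$ by the value $0$. For every compact subset $K$ of $\overline{\mathbb C}\setminus\Gamma_1$ the polynomial $Q_n$ has no zeros on $K\cap\mathbb C$ for all sufficiently large $n$, and $$\lim_{n\to\infty}\frac{Q_{n-j}(\lambda)}{Q_n(\lambda)}=z_0(\lambda)^j$$ uniformly on $K$. -/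

import Mathlib

open Polynomial Filter Topology Bornology

noncomputable section

namespace ToeplitzRec

/-- The Hilbert space `ℓ²` of square-summable complex sequences indexed by `0, 1, 2, …`. -/
abbrev Ell2 : Type := lp (fun _ : ℕ => ℂ) 2

/-- The unit vector of `ℓ²` with `1` in the entry of index `i` (entries are counted from `0`). -/
def basisVec (i : ℕ) : Ell2 := lp.single 2 i (1 : ℂ)

theorem memℓp_left (x : Ell2) : Memℓp (fun n : ℕ => x (n + 1)) 2 := by
  refine memℓp_gen ?_
  exact (summable_nat_add_iff (f := fun n => ‖x n‖ ^ (2 : ENNReal).toReal) 1).2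
    ((lp.memℓp x).summable (by norm_num))

theorem memℓp_right (x : Ell2) :
    Memℓp (fun n : ℕ => if n = 0 then (0 : ℂ) else x (n - 1)) 2 := by
  refine memℓp_gen ?_
  rw [← summable_nat_add_iff 1]
  simpa using (lp.memℓp x).summable (by norm_num)

/-- The backward shift `(x₀, x₁, …) ↦ (x₁, x₂, …)` on `ℓ²`. -/
def leftShift : Ell2 →L[ℂ] Ell2 :=
  LinearMap.mkContinuous
    { toFun := fun x => ⟨fun n => x (n + 1), memℓp_left x⟩
      map_add' := fun x y => by ext n; rfl
      map_smul' := fun c x => by ext n; simp } 1 (fun x => by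
    rw [one_mul]
    refine lp.norm_le_of_tsum_le (by norm_num) (norm_nonneg x) ?_
    rw [lp.norm_rpow_eq_tsum (by norm_num) x]
    have hs := (lp.memℓp x).summable (by norm_num : 0 < (2 : ENNReal).toReal)
    have h := hs.sum_add_tsum_nat_add 1
    rw [← h]
    simp only [LinearMap.coe_mk, AddHom.coe_mk]
    have : 0 ≤ ∑ i ∈ Finset.range 1, ‖x i‖ ^ (2 : ENNReal).toReal :=
      Finset.sum_nonneg fun i _ => by positivity
    linarith)

/-- The forward shift `(x₀, x₁, …) ↦ (0, x₀, x₁, …)` on `ℓ²`. -/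
def rightShift : Ell2 →L[ℂ] Ell2 :=
  LinearMap.mkContinuous
    { toFun := fun x => ⟨fun n => if n = 0 then 0 else x (n - 1), memℓp_right x⟩
      map_add' := fun x y => by
        ext n
        change (if n = 0 then (0 : ℂ) else (x + y) (n - 1)) =
          (if n = 0 then 0 else x (n - 1)) + (if n = 0 then 0 else y (n - 1))
        by_cases h : n = 0 <;> simp [h]
      map_smul' := fun c x => by ext n; by_cases h : n = 0 <;> simp [h] } 1 (fun x => by
    rw [one_mul]
    refine lp.norm_le_of_tsum_le (by norm_num) (norm_nonneg x) ?_
    rw [lp.norm_rpow_eq_tsum (by norm_num) x]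
    have hs := (memℓp_right x).summable (by norm_num : 0 < (2 : ENNReal).toReal)
    have h := hs.sum_add_tsum_nat_add 1
    simp only [LinearMap.coe_mk, AddHom.coe_mk]
    rw [← h]
    simp)

variable {p : ℕ}

/-- The entry of index `(i, j)`, `i, j = 0, 1, …`, of the infinite banded Hessenberg (Toeplitz)
matrix `A` with `1` on the first superdiagonal, `a k` on the `k`-th subdiagonal for `0 ≤ k ≤ p`
and `0` elsewhere. -/
def toeplitzMatrix (a : Fin (p + 1) → ℂ) (i j : ℕ) : ℂ :=
  if j = i + 1 then 1
  else if h : j ≤ i ∧ i - j < p + 1 then a ⟨i - j, h.2⟩ else 0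

/-- The bounded operator on `ℓ²` given by the matrix `A`. -/
def toeplitzOp (a : Fin (p + 1) → ℂ) : Ell2 →L[ℂ] Ell2 :=
  leftShift + ∑ k : Fin (p + 1), a k • rightShift ^ (k : ℕ)

/-- `g_j(w) = (R_w e_{j-1}, e_0)` with `R_w = (w I - A)⁻¹`. The inner product of Mathlib is linear
in its second argument, so its arguments are swapped. -/
def resolventFun (a : Fin (p + 1) → ℂ) (j : ℕ) (w : ℂ) : ℂ :=
  inner ℂ (basisVec 0) (resolvent (toeplitzOp a) w (basisVec (j - 1)))

/-- `v_j = e_0 + ⋯ + e_{j-1}`. -/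
def vVec (j : ℕ) : Ell2 := ∑ i ∈ Finset.range j, basisVec i

/-- The linear functional on polynomials with `L_j(X ^ n) = (A ^ n v_j, e_0)`. -/
def LFun (a : Fin (p + 1) → ℂ) (j : ℕ) : ℂ[X] →ₗ[ℂ] ℂ where
  toFun P := inner ℂ (basisVec 0) (aeval (toeplitzOp a) P (vVec j))
  map_add' P R := by simp
  map_smul' c P := by simp

/-- The polynomials `Q_0, Q_1, …`: `Q_0 = 1` and
`Q_{n+1} = X Q_n - a_0 Q_n - ⋯ - a_p Q_{n-p}`, where polynomials of negative index are zero. -/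
def recPolyNat (a : Fin (p + 1) → ℂ) : ℕ → ℂ[X]
  | 0 => 1
  | n + 1 => X * recPolyNat a n -
      ∑ k : Fin (p + 1), if (k : ℕ) ≤ n then C (a k) * recPolyNat a (n - k) else 0
  termination_by n => n
  decreasing_by all_goals omega

/-- The polynomials `Q_n` for all integers `n`, with `Q_n = 0` for `n < 0`. -/
def QPoly (a : Fin (p + 1) → ℂ) : ℤ → ℂ[X]
  | Int.ofNat n => recPolyNat a n
  | Int.negSucc _ => 0

/-- The symbol `a(z) = 1 / z + a_0 + a_1 z + ⋯ + a_p z ^ p`. -/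
def symbol (a : Fin (p + 1) → ℂ) (z : ℂ) : ℂ := z⁻¹ + ∑ k : Fin (p + 1), a k * z ^ (k : ℕ)

/-- The polynomial `z (a(z) - w)` in `z`; its zeros are the solutions of `a(z) = w`. -/
def symbolPoly (a : Fin (p + 1) → ℂ) (w : ℂ) : ℂ[X] :=
  1 + ∑ k : Fin (p + 1), C (a k) * X ^ ((k : ℕ) + 1) - C w * X

/-- `z_0(w), …, z_p(w)` are, for every `w`, the `p + 1` solutions of `a(z) = w` counted with
multiplicity and labelled so that `|z_0(w)| ≤ ⋯ ≤ |z_p(w)|`. Ties are broken arbitrarily. -/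
def IsOrderedSolution (a : Fin (p + 1) → ℂ) (z : Fin (p + 1) → ℂ → ℂ) : Prop :=
  ∀ w : ℂ, (symbolPoly a w).roots = Multiset.map (fun k => z k w) Finset.univ.val ∧
    Monotone fun k => ‖z k w‖

/-- `Gamma z i` is the set `Γ_{i+1} = {w : |z_i(w)| = |z_{i+1}(w)|}`, `i = 0, …, p - 1`. -/
def Gamma (z : Fin (p + 1) → ℂ → ℂ) (i : Fin p) : Set ℂ :=
  {w | ‖z i.castSucc w‖ = ‖z i.succ w‖}

/-- The component `n_j`, `1 ≤ j ≤ p`, of the staircase multi-index of `n = m p + k`,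
`0 ≤ k < p`: it is `m + 1` for `j ≤ k` and `m` for `j > k`. -/
def stair (p n j : ℕ) : ℕ := if j ≤ n % p then n / p + 1 else n / p

/-- `f(w) = c_0 / w + c_1 / w ^ 2 + ⋯` for all `w` in a neighbourhood of infinity. -/
def HasLaurentAtInfty (f : ℂ → ℂ) (c : ℕ → ℂ) : Prop :=
  ∀ᶠ w in cobounded ℂ, HasSum (fun m : ℕ => c m / w ^ (m + 1)) (f w)

/-- `(P_1 / D, …, P_p / D)` is a type II Hermite–Padé approximant to `(f_1, …, f_p)` at infinity
for the multi-index `(ν_1, …, ν_p)`: `D` is a nonzero polynomial of degree at most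
`ν_1 + ⋯ + ν_p`, the `P_j` are polynomials, and `D f_j - P_j = O(1 / w ^ (ν_j + 1))`. -/
def IsTypeIIHermitePade (p : ℕ) (f : ℕ → ℂ → ℂ) (ν : ℕ → ℕ) (D : ℂ[X]) (P : ℕ → ℂ[X]) : Prop :=
  D ≠ 0 ∧ D.natDegree ≤ ∑ j ∈ Finset.Icc 1 p, ν j ∧
    ∀ j ∈ Finset.Icc 1 p,
      (fun w : ℂ => D.eval w * f j w - (P j).eval w) =O[cobounded ℂ]
        fun w : ℂ => 1 / w ^ (ν j + 1)

/-- The extension of `f : ℂ → ℂ` to the extended plane by the value `0` at infinity. -/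
def extendByZero (f : ℂ → ℂ) (w : OnePoint ℂ) : ℂ := w.elim 0 f

theorem leftShift_apply (x : Ell2) (n : ℕ) : leftShift x n = x (n + 1) := rfl

theorem rightShift_apply (x : Ell2) (n : ℕ) :
    rightShift x n = if n = 0 then 0 else x (n - 1) := rfl

theorem rightShift_pow_apply (k : ℕ) (x : Ell2) (n : ℕ) :
    (rightShift ^ k) x n = if k ≤ n then x (n - k) else 0 := by
  induction k generalizing n with
  | zero => simp
  | succ k ih =>
    rw [pow_succ', mul_apply_eq_comp, rightShift_apply]
    rcases n with _ | n
    · simp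
    · rw [if_neg (by omega), ih]
      simp

/-- The operator acts on a sequence by the recurrence. -/
theorem toeplitzOp_apply (a : Fin (p + 1) → ℂ) (x : Ell2) (n : ℕ) :
    toeplitzOp a x n =
      x (n + 1) + ∑ k : Fin (p + 1), if (k : ℕ) ≤ n then a k * x (n - k) else 0 := by
  simp only [toeplitzOp, _root_.add_apply, lp.coeFn_add, Pi.add_apply,
    leftShift_apply, _root_.sum_apply, lp.coeFn_sum, Finset.sum_apply,
    _root_.smul_apply, lp.coeFn_smul, Pi.smul_apply, rightShift_pow_apply,
    smul_eq_mul, mul_ite, mul_zero]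

theorem inner_e (i : ℕ) (x : Ell2) : inner ℂ (basisVec i) x = x i := by
  simp [basisVec, lp.inner_single_left]

/-- The matrix entries of the operator are those of `A`. -/
theorem inner_toeplitzOp (a : Fin (p + 1) → ℂ) (i j : ℕ) :
    inner ℂ (basisVec i) (toeplitzOp a (basisVec j)) = toeplitzMatrix a i j := by
  have he : ∀ m, (basisVec j) m = if m = j then (1 : ℂ) else 0 := fun m => by
    simp [basisVec, lp.single_apply, Pi.single_apply]
  rw [inner_e, toeplitzOp_apply]
  simp only [he, toeplitzMatrix]
  by_cases h1 : j = i + 1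
  · subst h1
    simp only [if_true]
    rw [Finset.sum_eq_zero, add_zero]
    intro k _
    split_ifs <;> first | omega | simp
  · rw [if_neg (fun h => h1 h.symm), if_neg h1, zero_add]
    by_cases h : j ≤ i ∧ i - j < p + 1
    · rw [dif_pos h, Finset.sum_eq_single ⟨i - j, h.2⟩]
      · have : i - (i - j) = j := by omega
        simp [this]
      · intro k _ hk
        have : (k : ℕ) ≠ i - j := fun hh => hk (Fin.ext hh)
        split_ifs <;> first | omega | simp
      · simp
    · rw [dif_neg h]
      refine Finset.sum_eq_zero fun k _ => ?_
      have := k.2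
      split_ifs <;> first | omega | simp

theorem LFun_X_pow (a : Fin (p + 1) → ℂ) (j n : ℕ) :
    LFun a j (X ^ n) = inner ℂ (basisVec 0) ((toeplitzOp a ^ n) (vVec j)) := by
  simp [LFun]

theorem QPoly_zero (a : Fin (p + 1) → ℂ) : QPoly a 0 = 1 := by
  change recPolyNat a 0 = 1
  rw [recPolyNat]

theorem QPoly_neg (a : Fin (p + 1) → ℂ) {n : ℤ} (hn : n < 0) : QPoly a n = 0 := by
  obtain ⟨m, rfl⟩ := Int.eq_negSucc_of_lt_zero hn
  rfl

/-- The `(p + 2)`-term recurrence. -/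
theorem QPoly_rec (a : Fin (p + 1) → ℂ) (n : ℕ) :
    X * QPoly a n = QPoly a (n + 1) + ∑ k : Fin (p + 1), C (a k) * QPoly a (n - (k : ℕ)) := by
  have h1 : QPoly a (n + 1) = recPolyNat a (n + 1) := rfl
  have h0 : QPoly a n = recPolyNat a n := rfl
  have hs : ∀ k : Fin (p + 1), C (a k) * QPoly a (n - (k : ℕ)) =
      if (k : ℕ) ≤ n then C (a k) * recPolyNat a (n - k) else 0 := fun k => by
    split_ifs with h
    · rw [← Nat.cast_sub h]; rfl
    · rw [QPoly_neg a (by omega), mul_zero]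
  rw [h1, h0, recPolyNat]
  simp only [hs]
  ring

theorem symbolPoly_eval (a : Fin (p + 1) → ℂ) (w z : ℂ) (hz : z ≠ 0) :
    (symbolPoly a w).eval z = z * (symbol a z - w) := by
  simp only [symbolPoly, symbol, eval_sub, eval_add, eval_one, eval_finsetSum, eval_mul, eval_C,
    eval_pow, eval_X, mul_sub, mul_add, mul_inv_cancel₀ hz, Finset.mul_sum]
  congr 1
  · congr 1
    exact Finset.sum_congr rfl fun k _ => by ring
  · ring

end ToeplitzRec

end

open ToeplitzRec

/-!
In terms of generating functions the recurrence says that `∑ Q_n(w) tⁿ` is the inverse of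
`t (a(t) - w) = ∏ (1 - t / z_k(w))`. Likewise, for `w` outside the spectrum of `A`, the entries
`x_n` of `x = (w - A)⁻¹ e_{j-1}` satisfy `(∑ x_n tⁿ) t (a(t) - w) = x_0 - t ^ j`.

The point `z_0` lies in the closed unit disc, since otherwise `(Q_n(w))` would be a summable
eigenvector of `A`. As `x_n → 0`, the product formula forces `x_0 - t ^ j` to vanish at `t = z_0`,
so `g_j = z_0 ^ j`. Comparing coefficients then gives `x_n = Q_n z_0 ^ j - Q_{n-j}`, and this is
small at infinity because `A ^ m e_{j-1}` has no entries beyond the index `j - 1 + p m`. The same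
band structure yields the orthogonality, as the `0`-th entry of `Q_n(A) y` is `y_n`.

Finally `z_0ⁿ Q_n` is the `n`-th partial sum of the coefficients of `∏_{k ≥ 1} (1 - t z_0 / z_k)⁻¹`,
so off `Γ_1` it converges, geometrically fast, to a limit bounded away from `0`. Uniformity up to
infinity rests on `z_0 / z_k → 0` there.
-/

namespace ToeplitzRec

section PowerSeries

open PowerSeries (rescale)

/-- The geometric power series `∑ xⁿ Xⁿ`, inverse to `1 - x X`. -/
noncomputable def geomSeries {R : Type*} [Semiring R] (x : R) : PowerSeries R :=
  PowerSeries.mk fun n => x ^ n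

@[simp]
theorem coeff_geomSeries {R : Type*} [Semiring R] (x : R) (n : ℕ) :
    PowerSeries.coeff n (geomSeries x) = x ^ n :=
  PowerSeries.coeff_mk _ _

theorem rescale_geomSeries {R : Type*} [CommSemiring R] (c x : R) :
    rescale c (geomSeries x) = geomSeries (c * x) := by
  ext n
  rw [PowerSeries.coeff_rescale, coeff_geomSeries, coeff_geomSeries, mul_pow]

theorem geomSeries_mul_one_sub {R : Type*} [CommRing R] (x : R) :
    geomSeries x * (1 - PowerSeries.C x * PowerSeries.X) = 1 := by
  have h := congrArg (rescale x) (PowerSeries.mk_one_mul_one_sub_eq_one R)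
  rw [map_mul, map_sub, map_one, PowerSeries.rescale_X, PowerSeries.rescale_mk] at h
  simpa only [Pi.one_apply, mul_one, geomSeries] using h

theorem coeff_geomSeries_one_mul {R : Type*} [CommSemiring R] (f : PowerSeries R) (n : ℕ) :
    PowerSeries.coeff n (geomSeries 1 * f) = ∑ m ∈ Finset.range (n + 1), PowerSeries.coeff m f := by
  rw [mul_comm, PowerSeries.coeff_mul, Finset.Nat.sum_antidiagonal_eq_sum_range_succ_mk]
  simp only [coeff_geomSeries, one_pow, mul_one]

section NormedRing

variable {R : Type*} [NormedCommRing R]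

theorem norm_coeff_prod_le [NormOneClass R] {ι : Type*} {s : Finset ι} {f : ι → PowerSeries R}
    {g : ι → PowerSeries ℝ}
    (h : ∀ k ∈ s, ∀ n, ‖PowerSeries.coeff n (f k)‖ ≤ PowerSeries.coeff n (g k)) (n : ℕ) :
    ‖PowerSeries.coeff n (∏ k ∈ s, f k)‖ ≤ PowerSeries.coeff n (∏ k ∈ s, g k) := by
  classical
  induction s using Finset.induction_on generalizing n with
  | empty =>
    rw [Finset.prod_empty, Finset.prod_empty, PowerSeries.coeff_one, PowerSeries.coeff_one]
    split_ifs <;> simp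
  | insert k s hk ih =>
    rw [Finset.forall_mem_insert] at h
    rw [Finset.prod_insert hk, Finset.prod_insert hk, PowerSeries.coeff_mul, PowerSeries.coeff_mul]
    refine norm_sum_le_of_le _ fun ij _ => (norm_mul_le _ _).trans ?_
    exact mul_le_mul (h.1 _) (ih h.2 _) (norm_nonneg _) ((norm_nonneg _).trans (h.1 _))

theorem summable_norm_coeff_mul {f g : PowerSeries R}
    (hf : Summable fun n => ‖PowerSeries.coeff n f‖)
    (hg : Summable fun n => ‖PowerSeries.coeff n g‖) :
    Summable fun n => ‖PowerSeries.coeff n (f * g)‖ := by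
  simpa only [PowerSeries.coeff_mul] using
    summable_norm_sum_mul_antidiagonal_of_summable_norm hf hg

theorem tsum_coeff_mul [CompleteSpace R] {f g : PowerSeries R}
    (hf : Summable fun n => ‖PowerSeries.coeff n f‖)
    (hg : Summable fun n => ‖PowerSeries.coeff n g‖) :
    ∑' n, PowerSeries.coeff n (f * g) =
      (∑' n, PowerSeries.coeff n f) * ∑' n, PowerSeries.coeff n g := by
  simpa only [PowerSeries.coeff_mul] using
    (tsum_mul_tsum_eq_tsum_sum_antidiagonal_of_summable_norm hf hg).symm

theorem summable_norm_coeff_prod {ι : Type*} {s : Finset ι} {f : ι → PowerSeries R}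
    (hf : ∀ k ∈ s, Summable fun n => ‖PowerSeries.coeff n (f k)‖) :
    Summable fun n => ‖PowerSeries.coeff n (∏ k ∈ s, f k)‖ := by
  refine Finset.prod_induction f (fun g => Summable fun n => ‖PowerSeries.coeff n g‖)
    (fun _ _ => summable_norm_coeff_mul) ?_ hf
  refine summable_of_ne_finset_zero (s := {0}) fun n hn => ?_
  rw [PowerSeries.coeff_one, if_neg (Finset.notMem_singleton.1 hn), norm_zero]

theorem tsum_coeff_prod [CompleteSpace R] {ι : Type*} {s : Finset ι} {f : ι → PowerSeries R}
    (hf : ∀ k ∈ s, Summable fun n => ‖PowerSeries.coeff n (f k)‖) :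
    ∑' n, PowerSeries.coeff n (∏ k ∈ s, f k) = ∏ k ∈ s, ∑' n, PowerSeries.coeff n (f k) := by
  classical
  induction s using Finset.induction_on with
  | empty => simp [PowerSeries.coeff_one]
  | insert k s hk ih =>
    rw [Finset.forall_mem_insert] at hf
    rw [Finset.prod_insert hk, Finset.prod_insert hk,
      tsum_coeff_mul hf.1 (summable_norm_coeff_prod hf.2), ih hf.2]

end NormedRing

section NormedField

variable {𝕜 : Type*} [NormedField 𝕜]

theorem summable_norm_coeff_prod_geomSeries {ι : Type*} {s : Finset ι} {x : ι → 𝕜}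
    (hx : ∀ k ∈ s, ‖x k‖ < 1) :
    Summable fun n => ‖PowerSeries.coeff n (∏ k ∈ s, geomSeries (x k))‖ :=
  summable_norm_coeff_prod fun k hk => by
    simpa only [coeff_geomSeries] using summable_norm_geometric_of_norm_lt_one (hx k hk)

theorem tsum_coeff_prod_geomSeries [CompleteSpace 𝕜] {ι : Type*} {s : Finset ι} {x : ι → 𝕜}
    (hx : ∀ k ∈ s, ‖x k‖ < 1) :
    ∑' n, PowerSeries.coeff n (∏ k ∈ s, geomSeries (x k)) = ∏ k ∈ s, (1 - x k)⁻¹ := by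
  rw [tsum_coeff_prod fun k hk => by
    simpa only [coeff_geomSeries] using summable_norm_geometric_of_norm_lt_one (hx k hk)]
  refine Finset.prod_congr rfl fun k hk => ?_
  simp only [coeff_geomSeries, tsum_geometric_of_norm_lt_one (hx k hk)]

theorem norm_coeff_prod_geomSeries_le {ι : Type*} {s : Finset ι} {x : ι → 𝕜} {q : ℝ}
    (hx : ∀ k ∈ s, ‖x k‖ ≤ q) (n : ℕ) :
    ‖PowerSeries.coeff n (∏ k ∈ s, geomSeries (x k))‖ ≤
      PowerSeries.coeff n (∏ _k ∈ s, geomSeries q) :=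
  norm_coeff_prod_le (fun k hk n => by
    rw [coeff_geomSeries, coeff_geomSeries, norm_pow]
    exact pow_le_pow_left₀ (norm_nonneg _) (hx k hk) n) n

theorem inv_two_pow_le_norm_prod_one_sub_inv {ι : Type*} {s : Finset ι} {x : ι → 𝕜}
    (hx : ∀ k ∈ s, ‖x k‖ < 1) : (2⁻¹ : ℝ) ^ s.card ≤ ‖∏ k ∈ s, (1 - x k)⁻¹‖ := by
  rw [norm_prod, ← Finset.prod_const]
  refine Finset.prod_le_prod (fun _ _ => by positivity) fun k hk => ?_
  have hne : 1 - x k ≠ 0 := fun h => by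
    simpa [← sub_eq_zero.1 h] using hx k hk
  rw [norm_inv]
  refine inv_anti₀ (norm_pos_iff.2 hne) ((norm_sub_le _ _).trans ?_)
  rw [norm_one]
  linarith [hx k hk]

theorem tendstoUniformlyOn_coeff_geomSeries_one_mul_prod {β ι : Type*} [CompleteSpace 𝕜]
    {s : Finset ι} {x : β → ι → 𝕜} {S : Set β} {q : ℝ} (hq : |q| < 1)
    (hx : ∀ b ∈ S, ∀ k ∈ s, ‖x b k‖ ≤ q) :
    TendstoUniformlyOn
      (fun n b => PowerSeries.coeff n (geomSeries 1 * ∏ k ∈ s, geomSeries (x b k)))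
      (fun b => ∏ k ∈ s, (1 - x b k)⁻¹) atTop S := by
  have hsum : Summable fun n => PowerSeries.coeff n (∏ _k ∈ s, geomSeries q) :=
    (summable_norm_coeff_prod_geomSeries (x := fun _ => q) fun _ _ => hq).of_norm
  have hlim := tendstoUniformlyOn_tsum_nat hsum
    (f := fun n b => PowerSeries.coeff n (∏ k ∈ s, geomSeries (x b k)))
    fun n b hb => norm_coeff_prod_geomSeries_le (hx b hb) n
  simp only [coeff_geomSeries_one_mul]
  refine TendstoUniformlyOn.congr_right
    (fun u hu => (tendsto_add_atTop_nat 1).eventually (hlim u hu)) fun b hb => ?_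
  exact tsum_coeff_prod_geomSeries fun k hk => (hx b hb k hk).trans_lt (lt_of_abs_lt hq)

theorem tendsto_coeff_mul_coe {f : PowerSeries 𝕜}
    (hf : Tendsto (fun n => PowerSeries.coeff n f) atTop (𝓝 0)) (P : 𝕜[X]) :
    Tendsto (fun n => PowerSeries.coeff n (f * (P : PowerSeries 𝕜))) atTop (𝓝 0) := by
  induction P using Polynomial.induction_on' with
  | add P Q hP hQ => simpa [mul_add] using hP.add hQ
  | monomial k c =>
    rw [← tendsto_add_atTop_iff_nat k]
    simpa [← C_mul_X_pow_eq_monomial, ← mul_assoc, PowerSeries.coeff_mul_X_pow] using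
      hf.mul_const c

theorem sum_range_coeff_mul_X_sub_C_mul_pow {R : Type*} [CommRing R] (f : PowerSeries R) (ζ : R)
    (n : ℕ) :
    ∑ i ∈ Finset.range (n + 1),
        PowerSeries.coeff i (f * (PowerSeries.X - PowerSeries.C ζ)) * ζ ^ i =
      -(ζ ^ (n + 1) * PowerSeries.coeff n f) := by
  induction n with
  | zero => simp [mul_sub, mul_comm]
  | succ n ih =>
    rw [Finset.sum_range_succ, ih, mul_sub, map_sub, PowerSeries.coeff_succ_mul_X,
      PowerSeries.coeff_mul_C]
    ring

theorem eval_eq_zero_of_mul_coe_eq_coe {f : PowerSeries 𝕜}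
    (hf : Tendsto (fun n => PowerSeries.coeff n f) atTop (𝓝 0)) {P F : 𝕜[X]}
    (h : f * (P : PowerSeries 𝕜) = (F : PowerSeries 𝕜)) {ζ : 𝕜} (hζ : P.IsRoot ζ) (hζ1 : ‖ζ‖ ≤ 1) :
    F.eval ζ = 0 := by
  obtain ⟨S, rfl⟩ := dvd_iff_isRoot.2 hζ
  have hF : f * (S : PowerSeries 𝕜) * (PowerSeries.X - PowerSeries.C ζ) = (F : PowerSeries 𝕜) := by
    rw [← h, Polynomial.coe_mul, Polynomial.coe_sub, Polynomial.coe_X, Polynomial.coe_C]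
    ring
  have hlim : Tendsto (fun n => -(ζ ^ (n + 1) * PowerSeries.coeff n (f * (S : PowerSeries 𝕜))))
      atTop (𝓝 0) := by
    refine squeeze_zero_norm (fun n => ?_) (tendsto_zero_iff_norm_tendsto_zero.1
      (tendsto_coeff_mul_coe hf S))
    rw [norm_neg, norm_mul, norm_pow]
    exact mul_le_of_le_one_left (norm_nonneg _) (pow_le_one₀ (norm_nonneg _) hζ1)
  refine tendsto_nhds_unique_of_eventuallyEq tendsto_const_nhds hlim ?_
  filter_upwards [eventually_ge_atTop F.natDegree] with n hn
  rw [← sum_range_coeff_mul_X_sub_C_mul_pow, hF, eval_eq_sum_range' (Nat.lt_succ_of_le hn)]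
  simp only [Polynomial.coeff_coe]

end NormedField

end PowerSeries

section UniformConvergence

theorem eventually_forall_half_le_norm {ι β E : Type*} [SeminormedAddCommGroup E] {l : Filter ι}
    {F : ι → β → E} {L : β → E} {S : Set β} {c : ℝ} (hF : TendstoUniformlyOn F L l S) (hc : 0 < c)
    (hL : ∀ b ∈ S, c ≤ ‖L b‖) : ∀ᶠ i in l, ∀ b ∈ S, c / 2 ≤ ‖F i b‖ := by
  filter_upwards [Metric.tendstoUniformlyOn_iff.1 hF (c / 2) (half_pos hc)] with i hi b hb
  have h := (norm_sub_norm_le (L b) (F i b)).trans (dist_eq_norm (L b) _ ▸ (hi b hb).le)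
  linarith [hL b hb]

theorem tendstoUniformlyOn_div_one {ι β 𝕜 : Type*} [NormedField 𝕜] {l : Filter ι}
    {F G : ι → β → 𝕜} {L : β → 𝕜} {S : Set β} {c : ℝ} (hF : TendstoUniformlyOn F L l S)
    (hG : TendstoUniformlyOn G L l S) (hc : 0 < c) (hL : ∀ b ∈ S, c ≤ ‖L b‖) :
    TendstoUniformlyOn (fun i b => F i b / G i b) 1 l S := by
  rw [Metric.tendstoUniformlyOn_iff] at hF ⊢
  intro ε hε
  have hδ : 0 < ε * (c / 2) / 2 := by positivity
  filter_upwards [hF _ hδ, Metric.tendstoUniformlyOn_iff.1 hG _ hδ,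
    eventually_forall_half_le_norm hG hc hL] with i hFi hGi hlow b hb
  have hpos : 0 < ‖G i b‖ := (half_pos hc).trans_le (hlow b hb)
  rw [Pi.one_apply, dist_comm, dist_eq_norm, div_sub_one (norm_pos_iff.1 hpos), norm_div,
    div_lt_iff₀ hpos, ← dist_eq_norm]
  calc dist (F i b) (G i b) ≤ dist (L b) (F i b) + dist (L b) (G i b) := dist_triangle_left _ _ _
    _ < ε * (c / 2) / 2 + ε * (c / 2) / 2 := add_lt_add (hFi b hb) (hGi b hb)
    _ = ε * (c / 2) := add_halves _
    _ ≤ ε * ‖G i b‖ := by gcongr; exact hlow b hb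

theorem tendstoUniformlyOn_mul_of_norm_le {ι β R : Type*} [NonUnitalSeminormedRing R]
    {l : Filter ι} {F : ι → β → R} {φ L : β → R} {S : Set β} {B : ℝ}
    (hF : TendstoUniformlyOn F L l S) (hφ : ∀ b ∈ S, ‖φ b‖ ≤ B) :
    TendstoUniformlyOn (fun i b => φ b * F i b) (fun b => φ b * L b) l S := by
  rw [Metric.tendstoUniformlyOn_iff] at hF ⊢
  intro ε hε
  filter_upwards [hF (ε / (|B| + 1)) (by positivity)] with i hi b hb
  have hφb : ‖φ b‖ < |B| + 1 := ((hφ b hb).trans (le_abs_self B)).trans_lt (lt_add_one _)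
  have hLF := hi b hb
  rw [dist_eq_norm] at hLF ⊢
  calc ‖φ b * L b - φ b * F i b‖ ≤ ‖φ b‖ * ‖L b - F i b‖ := by
        rw [← mul_sub]; exact norm_mul_le _ _
    _ ≤ (|B| + 1) * ‖L b - F i b‖ := by gcongr
    _ < (|B| + 1) * (ε / (|B| + 1)) := by gcongr
    _ = ε := mul_div_cancel₀ _ (by positivity)

end UniformConvergence

section Resolvent

theorem pow_smul_resolvent {R A : Type*} [CommRing R] [Ring A] [Algebra R A] {a : A} {w : R}
    (hw : w ∈ resolventSet R a) (N : ℕ) :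
    w ^ N • resolvent a w =
      a ^ N * resolvent a w + ∑ m ∈ Finset.range N, w ^ m • a ^ (N - 1 - m) := by
  have hinv : (algebraMap R A w - a) * resolvent a w = 1 := Ring.mul_inverse_cancel _ hw
  have h := congrArg (· * resolvent a w) ((Algebra.commute_algebraMap_left w a).geom_sum₂_mul N)
  simp only [mul_assoc, hinv, mul_one, sub_mul, ← map_pow, ← Algebra.smul_def] at h
  rw [h, add_sub_cancel]

variable {𝕜 A F : Type*} [NontriviallyNormedField 𝕜] [NormedRing A] [NormedAlgebra 𝕜 A]
  [NormedAddCommGroup F] [NormedSpace 𝕜 F]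

theorem hasSum_clm_resolvent [CompleteSpace A] (φ : A →L[𝕜] F) (a : A) :
    ∀ᶠ w in cobounded 𝕜, HasSum (fun m => (w ^ (m + 1))⁻¹ • φ (a ^ m)) (φ (resolvent a w)) := by
  have hsmall : Tendsto (fun w : 𝕜 => w⁻¹ • a) (cobounded 𝕜) (𝓝 0) := by
    simpa using (tendsto_inv₀_cobounded (α := 𝕜)).smul_const a
  filter_upwards [hsmall.norm.eventually_lt_const (by simp : ‖(0 : A)‖ < 1),
    eventually_ne_cobounded (0 : 𝕜)] with w hlt hw0
  have hres : w⁻¹ • Ring.inverse (1 - w⁻¹ • a) = resolvent a w := by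
    have h := spectrum.units_smul_resolvent_self (r := Units.mk0 w hw0) (a := a)
    simp only [resolvent, map_one, Units.smul_def, Units.val_mk0, Units.val_inv_eq_inv_val] at h
    rw [← h, inv_smul_smul₀ hw0, resolvent]
  have h := ((hasSum_geom_series_inverse _ hlt).const_smul w⁻¹).mapL φ
  simpa only [hres, _root_.smul_pow, map_smul, smul_smul, inv_pow, ← mul_inv, ← pow_succ'] using h

theorem isBigO_clm_resolvent [CompleteSpace A] (φ : A →L[𝕜] F) {a : A} {N : ℕ}
    (h : ∀ m < N, φ (a ^ m) = 0) :
    (fun w => φ (resolvent a w)) =O[cobounded 𝕜] fun w => (w ^ (N + 1))⁻¹ := by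
  have hO : (fun w => (w ^ N)⁻¹ • φ (a ^ N * resolvent a w)) =O[cobounded 𝕜]
      fun w => (w ^ N)⁻¹ • w⁻¹ :=
    (Asymptotics.isBigO_refl _ _).smul
      (((φ.comp (ContinuousLinearMap.mul 𝕜 A (a ^ N))).isBigO_comp _ _).trans
        (spectrum.resolvent_isBigO_inv a))
  refine hO.congr' ?_ (.of_eq <| funext fun w => by rw [smul_eq_mul, ← mul_inv, ← pow_succ])
  filter_upwards [spectrum.eventually_isUnit_resolvent (𝕜 := 𝕜) a, eventually_ne_cobounded (0 : 𝕜)]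
    with w hw hw0
  have hpow := congrArg φ (pow_smul_resolvent (spectrum.isUnit_resolvent.2 hw) N)
  have hsum : ∑ m ∈ Finset.range N, w ^ m • φ (a ^ (N - 1 - m)) = 0 :=
    Finset.sum_eq_zero fun m hm => by
      rw [h _ (by have := Finset.mem_range.1 hm; omega), smul_zero]
  simp only [map_add, map_smul, map_sum, hsum, add_zero] at hpow
  rw [← hpow, inv_smul_smul₀ (pow_ne_zero N hw0)]

end Resolvent

section Polynomial

variable {ι : Type*} {l : Filter ι} {N : ℕ}

theorem eq_prod_roots_one_sub {K : Type*} [Field K] {P : K[X]} (hP : P.Splits)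
    (h0 : P.coeff 0 = 1) : P = (P.roots.map fun ζ => 1 - C ζ⁻¹ * X).prod := by
  have hroot : ∀ ζ ∈ P.roots, X - C ζ = C (-ζ) * (1 - C ζ⁻¹ * X) := fun ζ hζ => by
    have hζ0 : ζ ≠ 0 := by
      rintro rfl
      rw [coeff_zero_eq_eval_zero, (isRoot_of_mem_roots hζ).eq_zero] at h0
      exact zero_ne_one h0
    rw [mul_sub, ← mul_assoc, ← C_mul, neg_mul, mul_inv_cancel₀ hζ0]
    simp [sub_eq_add_neg, add_comm]
  have hprod := hP.eq_prod_roots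
  have hneg : (P.roots.map fun ζ => C (-ζ)).prod = C (P.roots.map Neg.neg).prod := by
    rw [map_multiset_prod, Multiset.map_map]
    rfl
  rw [Multiset.map_congr rfl hroot, Multiset.prod_map_mul, hneg, ← mul_assoc, ← C_mul] at hprod
  have hc := congrArg (eval 0) hprod
  rw [← coeff_zero_eq_eval_zero, h0, eval_mul, eval_C, eval_multiset_prod, Multiset.map_map] at hc
  simp only [Function.comp_def, eval_sub, eval_one, eval_mul, eval_C, eval_X, mul_zero, sub_zero,
    Multiset.map_const', Multiset.prod_replicate, one_pow, mul_one] at hc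
  rwa [← hc, C_1, one_mul] at hprod

theorem eq_of_monotone_of_map_eq {α : Type*} [PartialOrder α] {f g : Fin N → α}
    (hf : Monotone f) (hg : Monotone g) (h : Finset.univ.val.map f = Finset.univ.val.map g) :
    f = g := by
  rw [Fin.univ_val_map, Fin.univ_val_map, Multiset.coe_eq_coe] at h
  exact List.ofFn_injective
    (h.eq_of_pairwise' hf.sortedLE_ofFn.pairwise hg.sortedLE_ofFn.pairwise)

theorem eq_C_leadingCoeff_mul_prod {K : Type*} [Field K] {P : K[X]} {r : Fin N → K}
    (hP : P.natDegree = N) (hr : P.roots = Finset.univ.val.map r) :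
    P = C P.leadingCoeff * ∏ k, (X - C (r k)) := by
  have h := C_leadingCoeff_mul_prod_multiset_X_sub_C (p := P) (by simp [hr, hP])
  rwa [hr, Multiset.map_map, eq_comm] at h

theorem tendsto_cauchyBound {K : Type*} [NormedField K] {P : ι → K[X]} {P₀ : K[X]}
    (hP : ∀ m, Tendsto (fun i => (P i).coeff m) l (𝓝 (P₀.coeff m)))
    (hdeg : ∀ i, (P i).natDegree = N) (hdeg₀ : P₀.natDegree = N) (hP₀ : P₀ ≠ 0) :
    Tendsto (fun i => cauchyBound (P i)) l (𝓝 (cauchyBound P₀)) := by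
  simp only [cauchyBound, leadingCoeff, hdeg, hdeg₀]
  refine ((Tendsto.finset_sup_nhds_apply fun m _ => (hP m).nnnorm).div (hP N).nnnorm ?_).add_const 1
  rwa [← hdeg₀, nnnorm_ne_zero_iff, coeff_natDegree, leadingCoeff_ne_zero]

theorem roots_eq_of_tendsto {K : Type*} [NontriviallyNormedField K] [l.NeBot] {P : ι → K[X]}
    {P₀ : K[X]} {r : ι → Fin N → K} {ζ : Fin N → K}
    (hP : ∀ m, Tendsto (fun i => (P i).coeff m) l (𝓝 (P₀.coeff m)))
    (hdeg : ∀ i, (P i).natDegree = N) (hdeg₀ : P₀.natDegree = N) (hP₀ : P₀ ≠ 0)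
    (hr : ∀ i, (P i).roots = Finset.univ.val.map (r i)) (hζ : Tendsto r l (𝓝 ζ)) :
    P₀.roots = Finset.univ.val.map ζ := by
  have hprod : P₀ = C P₀.leadingCoeff * ∏ k, (X - C (ζ k)) := by
    refine Polynomial.funext fun x => ?_
    have heval : Tendsto (fun i => (P i).eval x) l (𝓝 (P₀.eval x)) := by
      simp only [eval_eq_sum_range, hdeg, hdeg₀]
      exact tendsto_finsetSum _ fun m _ => (hP m).mul_const _
    refine tendsto_nhds_unique heval ?_
    simp only [fun i => congrArg (eval x) (eq_C_leadingCoeff_mul_prod (hdeg i) (hr i)), eval_mul,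
      eval_C, eval_prod, eval_sub, eval_X, leadingCoeff, hdeg, hdeg₀]
    exact (hP N).mul (tendsto_finsetProd _ fun k _ =>
      tendsto_const_nhds.sub (tendsto_pi_nhds.1 hζ k))
  have hroots := roots_multiset_prod_X_sub_C (Finset.univ.val.map ζ)
  rw [Multiset.map_map] at hroots
  rw [hprod, roots_C_mul _ (leadingCoeff_ne_zero.2 hP₀)]
  exact hroots

theorem eventually_roots_mem_closedBall {K : Type*} [NormedField K] {P : ι → K[X]} {P₀ : K[X]}
    {r : ι → Fin N → K}
    (hP : ∀ m, Tendsto (fun i => (P i).coeff m) l (𝓝 (P₀.coeff m)))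
    (hdeg : ∀ i, (P i).natDegree = N) (hdeg₀ : P₀.natDegree = N) (hP₀ : P₀ ≠ 0)
    (hr : ∀ i, (P i).roots = Finset.univ.val.map (r i)) :
    ∀ᶠ i in l, r i ∈ Metric.closedBall 0 (cauchyBound P₀ + 1 : ℝ) := by
  filter_upwards [(tendsto_cauchyBound hP hdeg hdeg₀ hP₀).eventually_le_const
    (lt_add_one (cauchyBound P₀))] with i hi
  rw [mem_closedBall_zero_iff, pi_norm_le_iff_of_nonneg (by positivity)]
  intro k
  have hk : r i k ∈ (P i).roots := by
    rw [hr]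
    exact Multiset.mem_map_of_mem _ (Finset.mem_univ k)
  have hlt := (isRoot_of_mem_roots hk).norm_lt_cauchyBound (ne_zero_of_mem_roots hk)
  exact_mod_cast hlt.le.trans hi

theorem tendsto_norm_root {K : Type*} [NontriviallyNormedField K] [ProperSpace K] {P : ι → K[X]}
    {P₀ : K[X]} {r : ι → Fin N → K} {r₀ : Fin N → K}
    (hP : ∀ m, Tendsto (fun i => (P i).coeff m) l (𝓝 (P₀.coeff m)))
    (hdeg : ∀ i, (P i).natDegree = N) (hdeg₀ : P₀.natDegree = N)
    (hr : ∀ i, (P i).roots = Finset.univ.val.map (r i)) (hr₀ : P₀.roots = Finset.univ.val.map r₀)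
    (hmono : ∀ i, Monotone fun k => ‖r i k‖) (hmono₀ : Monotone fun k => ‖r₀ k‖) (k : Fin N) :
    Tendsto (fun i => ‖r i k‖) l (𝓝 ‖r₀ k‖) := by
  rw [tendsto_iff_ultrafilter]
  intro U hU
  have hP₀ : P₀ ≠ 0 := ne_zero_of_natDegree_gt (hdeg₀ ▸ k.pos)
  obtain ⟨ζ, -, hζ : Tendsto r U (𝓝 ζ)⟩ :=
    (isCompact_closedBall (0 : Fin N → K) (cauchyBound P₀ + 1 : ℝ)).ultrafilter_le_nhds (U.map r)
      (le_principal_iff.2 (hU (eventually_roots_mem_closedBall hP hdeg hdeg₀ hP₀ hr)))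
  have hroots := roots_eq_of_tendsto (fun m => (hP m).mono_left hU) hdeg hdeg₀ hP₀ hr hζ
  have hζk := tendsto_pi_nhds.1 hζ
  have hmonoζ : Monotone fun k => ‖ζ k‖ := fun k m hkm =>
    le_of_tendsto_of_tendsto' (hζk k).norm (hζk m).norm fun i => hmono i hkm
  have hnorm := congrArg (Multiset.map norm) (hroots.symm.trans hr₀)
  rw [Multiset.map_map, Multiset.map_map] at hnorm
  rw [← congrFun (eq_of_monotone_of_map_eq hmonoζ hmono₀ hnorm) k]
  exact (hζk k).norm

end Polynomial

section Operator

variable {p : ℕ} {a : Fin (p + 1) → ℂ} {w : ℂ}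

theorem basisVec_apply (i n : ℕ) : basisVec i n = if n = i then (1 : ℂ) else 0 := by
  simp [basisVec, lp.single_apply, Pi.single_apply]

theorem tendsto_apply_zero (x : Ell2) : Tendsto (fun n => x n) atTop (𝓝 0) := by
  have hsq := ((lp.memℓp x).summable (by norm_num)).tendsto_atTop_zero
  simp only [ENNReal.toReal_ofNat, Real.rpow_ofNat] at hsq
  rw [tendsto_zero_iff_norm_tendsto_zero]
  simpa using hsq.sqrt

/-- The matrix entry `T ↦ (T e_j)_i` as a continuous linear functional of the operator `T`. -/
noncomputable def entry (i j : ℕ) : (Ell2 →L[ℂ] Ell2) →L[ℂ] ℂ :=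
  (innerSL ℂ (basisVec i)).comp (ContinuousLinearMap.apply ℂ Ell2 (basisVec j))

theorem entry_apply (i j : ℕ) (T : Ell2 →L[ℂ] Ell2) : entry i j T = T (basisVec j) i :=
  inner_e i _

theorem smul_resolvent_sub_toeplitzOp (hw : w ∈ resolventSet ℂ (toeplitzOp a)) (x : Ell2) :
    w • resolvent (toeplitzOp a) w x - toeplitzOp a (resolvent (toeplitzOp a) w x) = x := by
  have h : (algebraMap ℂ (Ell2 →L[ℂ] Ell2) w - toeplitzOp a) * resolvent (toeplitzOp a) w = 1 :=
    Ring.mul_inverse_cancel _ hw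
  simpa [Algebra.algebraMap_eq_smul_one] using DFunLike.congr_fun h x

theorem eq_zero_of_smul_eq_toeplitzOp (hw : w ∈ resolventSet ℂ (toeplitzOp a)) {x : Ell2}
    (hx : w • x = toeplitzOp a x) : x = 0 := by
  have h : resolvent (toeplitzOp a) w * (algebraMap ℂ (Ell2 →L[ℂ] Ell2) w - toeplitzOp a) = 1 :=
    Ring.inverse_mul_cancel _ hw
  simpa [Algebra.algebraMap_eq_smul_one, hx] using (DFunLike.congr_fun h x).symm

theorem toeplitzOp_pow_apply_eq_zero (a : Fin (p + 1) → ℂ) {x : Ell2} {s : ℕ}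
    (hx : ∀ n, s < n → x n = 0) (k : ℕ) {n : ℕ} (hn : s + p * k < n) :
    (toeplitzOp a ^ k) x n = 0 := by
  induction k generalizing n with
  | zero => exact hx n hn
  | succ k ih =>
    rw [mul_add, mul_one] at hn
    rw [pow_succ', mul_apply_eq_comp, toeplitzOp_apply, ih (by omega), zero_add]
    refine Finset.sum_eq_zero fun i _ => ?_
    rw [ih (by omega), mul_zero, ite_self]

theorem mk_mul_symbolPoly (a : Fin (p + 1) → ℂ) (w : ℂ) (x : ℕ → ℂ) :
    PowerSeries.mk x * (symbolPoly a w : PowerSeries ℂ) =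
      PowerSeries.C (x 0) - PowerSeries.X * PowerSeries.mk fun n =>
        w * x n - (x (n + 1) + ∑ k : Fin (p + 1), if (k : ℕ) ≤ n then a k * x (n - k) else 0) := by
  have hcoe : (symbolPoly a w : PowerSeries ℂ) =
      1 + ∑ k : Fin (p + 1), PowerSeries.X ^ ((k : ℕ) + 1) * PowerSeries.C (a k) -
        PowerSeries.X * PowerSeries.C w := by
    have hsum := map_sum (coeToPowerSeries.ringHom (R := ℂ))
      (fun k : Fin (p + 1) => C (a k) * X ^ ((k : ℕ) + 1)) Finset.univ
    simp only [coeToPowerSeries.ringHom_apply] at hsum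
    rw [symbolPoly, coe_sub, coe_add, hsum]
    simp only [coe_one, coe_mul, coe_C, coe_pow, coe_X, mul_comm (PowerSeries.C _)]
  ext n
  rw [hcoe, mul_sub, mul_add, mul_one, Finset.mul_sum, map_sub, map_add, map_sum, map_sub]
  simp only [← mul_assoc, PowerSeries.coeff_mul_C, PowerSeries.coeff_mul_X_pow']
  rcases n with _ | n
  · simp
  · simp only [PowerSeries.coeff_succ_mul_X, PowerSeries.coeff_succ_X_mul, PowerSeries.coeff_mk,
      PowerSeries.coeff_C, Nat.add_le_add_iff_right, Nat.add_sub_add_right, ite_mul, zero_mul,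
      if_neg (Nat.succ_ne_zero n), mul_comm (a _)]
    ring

theorem mk_apply_mul_symbolPoly (a : Fin (p + 1) → ℂ) (w : ℂ) (x : Ell2) :
    PowerSeries.mk ⇑x * (symbolPoly a w : PowerSeries ℂ) =
      PowerSeries.C (x 0) - PowerSeries.X * PowerSeries.mk ⇑(w • x - toeplitzOp a x) := by
  rw [mk_mul_symbolPoly]
  congr! 3
  funext n
  rw [lp.coeFn_sub, Pi.sub_apply, toeplitzOp_apply, lp.coeFn_smul, Pi.smul_apply, smul_eq_mul]

theorem QPoly_succ (a : Fin (p + 1) → ℂ) (n : ℕ) :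
    QPoly a (n + 1 : ℕ) = X * QPoly a n -
      ∑ k : Fin (p + 1), if (k : ℕ) ≤ n then C (a k) * QPoly a (n - k : ℕ) else 0 := by
  change recPolyNat a (n + 1) = _
  rw [recPolyNat]
  rfl

theorem mk_QPoly_mul_symbolPoly (a : Fin (p + 1) → ℂ) (w : ℂ) :
    (PowerSeries.mk fun n : ℕ => (QPoly a n).eval w) * (symbolPoly a w : PowerSeries ℂ) = 1 := by
  have hrec : ∀ n : ℕ, w * (QPoly a n).eval w - ((QPoly a (n + 1 : ℕ)).eval w +
      ∑ k : Fin (p + 1), if (k : ℕ) ≤ n then a k * (QPoly a (n - k : ℕ)).eval w else 0) = 0 :=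
    fun n => by
      rw [QPoly_succ, eval_sub, eval_mul, eval_X, eval_finsetSum]
      simp only [apply_ite (eval w), eval_mul, eval_C, eval_zero]
      ring
  simp only [mk_mul_symbolPoly, hrec, Nat.cast_zero, QPoly_zero, eval_one, map_one]
  exact sub_eq_self.2 (mul_zero _)

theorem mk_resolvent_mul_symbolPoly (hw : w ∈ resolventSet ℂ (toeplitzOp a)) (j : ℕ) :
    PowerSeries.mk ⇑(resolvent (toeplitzOp a) w (basisVec j)) * (symbolPoly a w : PowerSeries ℂ) =
      (C (resolvent (toeplitzOp a) w (basisVec j) 0) - X ^ (j + 1) : ℂ[X]) := by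
  have hmk : PowerSeries.mk ⇑(basisVec j) = PowerSeries.X ^ j := by
    ext n
    rw [PowerSeries.coeff_mk, basisVec_apply, PowerSeries.coeff_X_pow]
  rw [mk_apply_mul_symbolPoly, smul_resolvent_sub_toeplitzOp hw, hmk, ← pow_succ']
  simp

theorem resolvent_basisVec_apply (hw : w ∈ resolventSet ℂ (toeplitzOp a)) (j n : ℕ) :
    resolvent (toeplitzOp a) w (basisVec j) n =
      (QPoly a n).eval w * resolvent (toeplitzOp a) w (basisVec j) 0 -
        (QPoly a (n - (j + 1 : ℕ))).eval w := by
  have h : PowerSeries.mk ⇑(resolvent (toeplitzOp a) w (basisVec j)) =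
      (PowerSeries.mk fun n : ℕ => (QPoly a n).eval w) *
        (PowerSeries.C (resolvent (toeplitzOp a) w (basisVec j) 0) - PowerSeries.X ^ (j + 1)) := by
    have h1 := mk_resolvent_mul_symbolPoly hw j
    simp only [Polynomial.coe_sub, Polynomial.coe_C, Polynomial.coe_pow, Polynomial.coe_X] at h1
    rw [← h1, mul_left_comm, mk_QPoly_mul_symbolPoly, mul_one]
  have hn := congrArg (PowerSeries.coeff n) h
  rw [PowerSeries.coeff_mk, mul_sub, map_sub, PowerSeries.coeff_mul_C,
    PowerSeries.coeff_mul_X_pow', PowerSeries.coeff_mk] at hn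
  rw [hn]
  congr 1
  split_ifs with hj
  · rw [PowerSeries.coeff_mk, Nat.cast_sub hj]
  · rw [QPoly_neg a (by omega), eval_zero]

theorem aeval_QPoly_apply_zero (a : Fin (p + 1) → ℂ) (n : ℕ) (x : Ell2) :
    aeval (toeplitzOp a) (QPoly a n) x 0 = x n := by
  induction n using Nat.strong_induction_on generalizing x with
  | _ n ih =>
  rcases n with _ | n
  · simp [QPoly_zero]
  · have hsum : (aeval (toeplitzOp a) (∑ k : Fin (p + 1),
        if (k : ℕ) ≤ n then C (a k) * QPoly a (n - k : ℕ) else 0) x : Ell2) 0 =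
        ∑ k : Fin (p + 1), if (k : ℕ) ≤ n then a k * x (n - k) else 0 := by
      rw [map_sum, _root_.sum_apply, lp.coeFn_sum, Finset.sum_apply]
      refine Finset.sum_congr rfl fun k _ => ?_
      split_ifs with hk
      · rw [map_mul, aeval_C, Algebra.algebraMap_eq_smul_one, smul_one_mul, _root_.smul_apply,
          lp.coeFn_smul, Pi.smul_apply, smul_eq_mul, ih (n - k) (by omega)]
      · simp
    rw [QPoly_succ, map_sub, _root_.sub_apply, lp.coeFn_sub, Pi.sub_apply, hsum, mul_comm X,
      map_mul, aeval_X, mul_apply_eq_comp, ih n (by omega), toeplitzOp_apply]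
    ring

theorem degree_QPoly (a : Fin (p + 1) → ℂ) (n : ℕ) : (QPoly a n).degree = n := by
  induction n using Nat.strong_induction_on with
  | _ n ih =>
  rcases n with _ | n
  · simp [QPoly_zero]
  · have hX : (X * QPoly a n).degree = ((n + 1 : ℕ) : WithBot ℕ) := by
      rw [degree_mul, degree_X, ih n (Nat.lt_succ_self n), add_comm, Nat.cast_succ]
    have hlt : (∑ k : Fin (p + 1), if (k : ℕ) ≤ n then C (a k) * QPoly a (n - k : ℕ)
        else 0).degree < (X * QPoly a n).degree := by
      rw [hX]
      refine (degree_sum_le _ _).trans_lt ((Finset.sup_lt_iff (WithBot.bot_lt_coe _)).2 ?_)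
      intro k _
      split_ifs
      · rw [← smul_eq_C_mul]
        refine (degree_smul_le _ _).trans_lt ?_
        rw [ih (n - k) (by omega)]
        exact_mod_cast Nat.lt_succ_of_le (n.sub_le k)
      · exact degree_zero.trans_lt (WithBot.bot_lt_coe _)
    rw [QPoly_succ, degree_sub_eq_left_of_degree_lt hlt, hX]

end Operator

section Solutions

variable {p : ℕ} {a : Fin (p + 1) → ℂ} {z : Fin (p + 1) → ℂ → ℂ} {w : ℂ}

theorem coeff_zero_symbolPoly (a : Fin (p + 1) → ℂ) (w : ℂ) : (symbolPoly a w).coeff 0 = 1 := by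
  simp [symbolPoly, coeff_zero_eq_eval_zero, eval_finsetSum]

theorem IsOrderedSolution.isRoot (hz : IsOrderedSolution a z) (k : Fin (p + 1)) (w : ℂ) :
    (symbolPoly a w).IsRoot (z k w) := by
  refine isRoot_of_mem_roots ?_
  rw [(hz w).1]
  exact Multiset.mem_map_of_mem _ (Finset.mem_univ k)

theorem IsOrderedSolution.ne_zero (hz : IsOrderedSolution a z) (k : Fin (p + 1)) (w : ℂ) :
    z k w ≠ 0 := fun h => by
  have hroot := hz.isRoot k w
  rw [h, IsRoot, ← coeff_zero_eq_eval_zero, coeff_zero_symbolPoly] at hroot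
  exact one_ne_zero hroot

theorem IsOrderedSolution.symbolPoly_eq_prod (hz : IsOrderedSolution a z) (w : ℂ) :
    symbolPoly a w = ∏ k, (1 - C (z k w)⁻¹ * X) := by
  rw [eq_prod_roots_one_sub (IsAlgClosed.splits _) (coeff_zero_symbolPoly a w), (hz w).1,
    Multiset.map_map]
  rfl

theorem IsOrderedSolution.natDegree_symbolPoly (hz : IsOrderedSolution a z) (w : ℂ) :
    (symbolPoly a w).natDegree = p + 1 := by
  rw [(IsAlgClosed.splits (symbolPoly a w)).natDegree_eq_card_roots, (hz w).1]
  simp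

theorem IsOrderedSolution.mk_QPoly_eq_prod (hz : IsOrderedSolution a z) (w : ℂ) :
    (PowerSeries.mk fun n : ℕ => (QPoly a n).eval w) = ∏ k, geomSeries (z k w)⁻¹ := by
  refine left_inv_eq_right_inv (mk_QPoly_mul_symbolPoly a w) ?_
  have hcoe := map_prod (coeToPowerSeries.ringHom (R := ℂ))
    (fun k : Fin (p + 1) => 1 - C (z k w)⁻¹ * X) Finset.univ
  simp only [coeToPowerSeries.ringHom_apply, coe_sub, coe_one, coe_mul, coe_C, coe_X] at hcoe
  rw [hz.symbolPoly_eq_prod, hcoe, mul_comm, ← Finset.prod_mul_distrib]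
  exact Finset.prod_eq_one fun k _ => geomSeries_mul_one_sub _

theorem not_summable_norm_QPoly (hw : w ∈ resolventSet ℂ (toeplitzOp a)) :
    ¬ Summable fun n : ℕ => ‖(QPoly a n).eval w‖ := fun hsum => by
  have hmem : Memℓp (fun n : ℕ => (QPoly a n).eval w) 2 :=
    (memℓp_gen (p := 1) (by simpa using hsum)).of_exponent_ge one_le_two
  let x : Ell2 := ⟨_, hmem⟩
  have hx0 : x 0 = 1 := by
    change (QPoly a (0 : ℕ)).eval w = 1
    rw [Nat.cast_zero, QPoly_zero, eval_one]
  have hmul : PowerSeries.X * PowerSeries.mk ⇑(w • x - toeplitzOp a x) = 0 := by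
    have h := (mk_apply_mul_symbolPoly a w x).symm.trans (mk_QPoly_mul_symbolPoly a w)
    rwa [hx0, map_one, sub_eq_self] at h
  have hzero : w • x - toeplitzOp a x = 0 := by
    ext n
    have hcoeff := congrArg (PowerSeries.coeff (n + 1)) hmul
    rwa [PowerSeries.coeff_succ_X_mul, PowerSeries.coeff_mk, map_zero] at hcoeff
  rw [eq_zero_of_smul_eq_toeplitzOp hw (sub_eq_zero.1 hzero)] at hx0
  exact zero_ne_one hx0

theorem IsOrderedSolution.norm_zero_le_one (hz : IsOrderedSolution a z)
    (hw : w ∈ resolventSet ℂ (toeplitzOp a)) : ‖z 0 w‖ ≤ 1 := by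
  by_contra! hlt
  have hinv : ∀ k ∈ Finset.univ, ‖(z k w)⁻¹‖ < 1 := fun k _ => by
    rw [norm_inv]
    exact inv_lt_one_of_one_lt₀ (hlt.trans_le ((hz w).2 (Fin.zero_le k)))
  refine not_summable_norm_QPoly hw ?_
  simpa only [← hz.mk_QPoly_eq_prod, PowerSeries.coeff_mk] using
    summable_norm_coeff_prod_geomSeries hinv

theorem IsOrderedSolution.resolvent_basisVec_apply_zero (hz : IsOrderedSolution a z)
    (hw : w ∈ resolventSet ℂ (toeplitzOp a)) (j : ℕ) :
    resolvent (toeplitzOp a) w (basisVec j) 0 = z 0 w ^ (j + 1) := by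
  have heval := eval_eq_zero_of_mul_coe_eq_coe
    (by simpa only [PowerSeries.coeff_mk] using tendsto_apply_zero _)
    (mk_resolvent_mul_symbolPoly hw j) (hz.isRoot 0 w) (hz.norm_zero_le_one hw)
  simpa [sub_eq_zero] using heval

theorem IsOrderedSolution.resolventFun_eq (hz : IsOrderedSolution a z)
    (hw : w ∈ resolventSet ℂ (toeplitzOp a)) {j : ℕ} (hj : 1 ≤ j) :
    resolventFun a j w = z 0 w ^ j := by
  rw [resolventFun, inner_e, hz.resolvent_basisVec_apply_zero hw, Nat.sub_add_cancel hj]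

theorem eventually_mem_resolventSet (a : Fin (p + 1) → ℂ) :
    ∀ᶠ w in cobounded ℂ, w ∈ resolventSet ℂ (toeplitzOp a) :=
  (spectrum.eventually_isUnit_resolvent (toeplitzOp a)).mono fun _ hw =>
    spectrum.isUnit_resolvent.2 hw

theorem hasLaurentAtInfty_resolventFun (a : Fin (p + 1) → ℂ) (j : ℕ) :
    HasLaurentAtInfty (resolventFun a j) fun m => entry 0 (j - 1) (toeplitzOp a ^ m) := by
  filter_upwards [hasSum_clm_resolvent (entry 0 (j - 1)) (toeplitzOp a)] with w hw
  simp only [smul_eq_mul, ← div_eq_inv_mul] at hw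
  exact hw

theorem IsOrderedSolution.hasLaurentAtInfty_pow (hz : IsOrderedSolution a z) {j : ℕ}
    (hj : 1 ≤ j) :
    HasLaurentAtInfty (fun w => z 0 w ^ j) fun m => entry 0 (j - 1) (toeplitzOp a ^ m) := by
  filter_upwards [hasLaurentAtInfty_resolventFun a j, eventually_mem_resolventSet a] with w h hw
  rwa [hz.resolventFun_eq hw hj] at h

end Solutions

section HermitePade

variable {p : ℕ} {a : Fin (p + 1) → ℂ} {z : Fin (p + 1) → ℂ → ℂ}

theorem sub_one_add_mul_lt_of_lt_stair {n j k : ℕ} (hj : j ∈ Finset.Icc 1 p)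
    (hk : k < stair p n j) : j - 1 + p * k < n := by
  rw [Finset.mem_Icc] at hj
  have hdiv := Nat.div_add_mod n p
  rw [stair] at hk
  split_ifs at hk with h
  · have : p * k ≤ p * (n / p) := Nat.mul_le_mul_left p (by omega)
    omega
  · have : p * (k + 1) ≤ p * (n / p) := Nat.mul_le_mul_left p (by omega)
    rw [mul_add] at this
    omega

theorem sum_stair (hp : 1 ≤ p) (n : ℕ) : ∑ j ∈ Finset.Icc 1 p, stair p n j = n := by
  have hstair : ∀ j, stair p n j = n / p + if j ≤ n % p then 1 else 0 := fun j => by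
    rw [stair]
    split_ifs <;> rfl
  have hfilter : (Finset.Icc 1 p).filter (fun j => j ≤ n % p) = Finset.Icc 1 (n % p) := by
    have hmod : n % p < p := Nat.mod_lt n hp
    ext j
    simp only [Finset.mem_filter, Finset.mem_Icc]
    omega
  simp only [hstair, Finset.sum_add_distrib, Finset.sum_const, Nat.card_Icc, smul_eq_mul,
    Finset.sum_boole, Nat.cast_id, hfilter, Nat.add_sub_cancel, Nat.div_add_mod]

theorem LFun_X_pow_mul_QPoly (a : Fin (p + 1) → ℂ) {n j k : ℕ}
    (hj : j ∈ Finset.Icc 1 p) (hk : k < stair p n j) :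
    LFun a j (X ^ k * QPoly a n) = 0 := by
  have hsupp : ∀ m, j - 1 < m → vVec j m = 0 := fun m hm => by
    rw [vVec, lp.coeFn_sum, Finset.sum_apply]
    refine Finset.sum_eq_zero fun i hi => ?_
    rw [Finset.mem_range] at hi
    rw [basisVec_apply, if_neg (by omega)]
  change inner ℂ (basisVec 0) (aeval (toeplitzOp a) (X ^ k * QPoly a n) (vVec j)) = 0
  rw [inner_e, mul_comm, map_mul, mul_apply_eq_comp, aeval_QPoly_apply_zero, map_pow, aeval_X]
  exact toeplitzOp_pow_apply_eq_zero a hsupp k (sub_one_add_mul_lt_of_lt_stair hj hk)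

theorem IsOrderedSolution.QPoly_mul_pow_sub_eventuallyEq (hz : IsOrderedSolution a z) (n : ℕ)
    {j : ℕ} (hj : 1 ≤ j) :
    (fun w => (QPoly a n).eval w * z 0 w ^ j - (QPoly a (n - j)).eval w) =ᶠ[cobounded ℂ]
      fun w => entry n (j - 1) (resolvent (toeplitzOp a) w) := by
  filter_upwards [eventually_mem_resolventSet a] with w hw
  rw [entry_apply, resolvent_basisVec_apply hw, hz.resolvent_basisVec_apply_zero hw,
    Nat.sub_add_cancel hj]

theorem IsOrderedSolution.isBigO_QPoly_mul_pow_sub (hz : IsOrderedSolution a z) (n : ℕ) {j : ℕ}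
    (hj : j ∈ Finset.Icc 1 p) :
    (fun w : ℂ => (QPoly a n).eval w * z 0 w ^ j - (QPoly a (n - j)).eval w)
      =O[cobounded ℂ] fun w : ℂ => 1 / w ^ (stair p n j + 1) := by
  have hentry : ∀ m < stair p n j, entry n (j - 1) (toeplitzOp a ^ m) = 0 := fun m hm => by
    rw [entry_apply]
    refine toeplitzOp_pow_apply_eq_zero a (fun i hi => ?_) m
      (sub_one_add_mul_lt_of_lt_stair hj hm)
    rw [basisVec_apply, if_neg hi.ne']
  simp only [one_div]
  exact (isBigO_clm_resolvent _ hentry).congr'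
    (hz.QPoly_mul_pow_sub_eventuallyEq n (Finset.mem_Icc.1 hj).1).symm EventuallyEq.rfl

theorem IsOrderedSolution.isTypeIIHermitePade (hp : 1 ≤ p) (hz : IsOrderedSolution a z) (n : ℕ) :
    IsTypeIIHermitePade p (fun j w => z 0 w ^ j) (stair p n) (QPoly a n)
      (fun j => QPoly a (n - j)) := by
  refine ⟨ne_zero_of_degree_gt (n := ⊥) ?_, ?_, fun j hj => hz.isBigO_QPoly_mul_pow_sub n hj⟩
  · rw [degree_QPoly]
    exact WithBot.bot_lt_coe n
  · rw [sum_stair hp]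
    exact natDegree_le_of_degree_le (degree_QPoly a n).le

theorem IsOrderedSolution.tendsto_pow_zero (hz : IsOrderedSolution a z) {j : ℕ} (hj : 1 ≤ j) :
    Tendsto (fun w => z 0 w ^ j) (cobounded ℂ) (𝓝 0) := by
  have hentry : Tendsto (fun w => entry 0 (j - 1) (resolvent (toeplitzOp a) w))
      (cobounded ℂ) (𝓝 0) :=
    (isBigO_clm_resolvent _ (N := 0) (by simp)).trans_tendsto
      (by simpa using tendsto_inv₀_cobounded (α := ℂ))
  refine hentry.congr' ?_
  filter_upwards [eventually_mem_resolventSet a] with w hw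
  rw [entry_apply, hz.resolvent_basisVec_apply_zero hw, Nat.sub_add_cancel hj]

theorem tendsto_QPoly_div_zero (a : Fin (p + 1) → ℂ) {j : ℕ} (hj : 1 ≤ j) (n : ℕ) :
    Tendsto (fun w => (QPoly a (n - j)).eval w / (QPoly a n).eval w) (cobounded ℂ) (𝓝 0) := by
  refine (Polynomial.isLittleO_cobounded_of_degree_lt ?_).tendsto_div_nhds_zero
  rw [degree_QPoly]
  rcases lt_or_ge n j with hlt | hle
  · rw [QPoly_neg a (by omega), degree_zero]
    exact WithBot.bot_lt_coe n
  · rw [← Nat.cast_sub hle, degree_QPoly]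
    exact_mod_cast Nat.sub_lt_self hj hle

end HermitePade

section RootModuli

variable {p : ℕ} {a : Fin (p + 1) → ℂ} {z : Fin (p + 1) → ℂ → ℂ}

theorem tendsto_coeff_symbolPoly (a : Fin (p + 1) → ℂ) (w₀ : ℂ) (m : ℕ) :
    Tendsto (fun w => (symbolPoly a w).coeff m) (𝓝 w₀) (𝓝 ((symbolPoly a w₀).coeff m)) := by
  simp only [symbolPoly, coeff_sub, coeff_C_mul]
  exact tendsto_const_nhds.sub (tendsto_id.mul_const _)

theorem IsOrderedSolution.continuous_norm (hz : IsOrderedSolution a z) (k : Fin (p + 1)) :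
    Continuous fun w => ‖z k w‖ :=
  continuous_iff_continuousAt.2 fun w₀ =>
    tendsto_norm_root (tendsto_coeff_symbolPoly a w₀) hz.natDegree_symbolPoly
      (hz.natDegree_symbolPoly w₀) (fun w => (hz w).1) (hz w₀).1 (fun w => (hz w).2) (hz w₀).2 k

theorem IsOrderedSolution.symbolPoly_comp_C_mul_X (hz : IsOrderedSolution a z) (w : ℂ) :
    (symbolPoly a w).comp (C (z 0 w) * X) = (1 - X) *
      (1 - ∑ m : Fin (p + 1), C (a m * z 0 w ^ ((m : ℕ) + 1)) *
        (X * ∑ i ∈ Finset.range m, X ^ i)) := by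
  have hroot : 1 + ∑ m : Fin (p + 1), a m * z 0 w ^ ((m : ℕ) + 1) - w * z 0 w = 0 := by
    simpa [symbolPoly, eval_finsetSum, IsRoot] using hz.isRoot 0 w
  have hw : C w * C (z 0 w) = 1 + ∑ m : Fin (p + 1), C (a m * z 0 w ^ ((m : ℕ) + 1)) := by
    rw [← C_mul, ← map_sum, ← C_1, ← C_add, sub_eq_zero.1 hroot]
  have hterm : ∀ m : Fin (p + 1), (1 - X) * (C (a m * z 0 w ^ ((m : ℕ) + 1)) *
      (X * ∑ i ∈ Finset.range m, X ^ i)) = C (a m * z 0 w ^ ((m : ℕ) + 1)) * X -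
        C (a m) * (C (z 0 w) * X) ^ ((m : ℕ) + 1) := fun m => by
    have hgeom := mul_neg_geom_sum (X : ℂ[X]) m
    rw [mul_pow, C_mul, C_pow]
    linear_combination C (a m) * C (z 0 w) ^ ((m : ℕ) + 1) * X * hgeom
  rw [mul_sub, Finset.mul_sum, Finset.sum_congr rfl fun m _ => hterm m, Finset.sum_sub_distrib,
    ← Finset.sum_mul]
  simp only [symbolPoly, sub_comp, add_comp, one_comp, Polynomial.sum_comp, mul_comp, C_comp,
    pow_comp, X_comp]
  linear_combination -X * hw

theorem IsOrderedSolution.sum_mul_geom_sum_eq_one (hz : IsOrderedSolution a z) (w : ℂ)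
    (k : Fin p) :
    ∑ m : Fin (p + 1), a m * z 0 w ^ ((m : ℕ) + 1) *
      (z k.succ w / z 0 w * ∑ i ∈ Finset.range m, (z k.succ w / z 0 w) ^ i) = 1 := by
  have hprod : (symbolPoly a w).comp (C (z 0 w) * X) =
      (1 - X) * ∏ k : Fin p, (1 - C (z 0 w / z k.succ w) * X) := by
    rw [hz.symbolPoly_eq_prod, prod_comp, Fin.prod_univ_succ]
    simp only [sub_comp, one_comp, mul_comp, C_comp, X_comp, ← mul_assoc, ← C_mul,
      inv_mul_cancel₀ (hz.ne_zero 0 w), C_1, one_mul, div_eq_inv_mul]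
  have h1X : (1 - X : ℂ[X]) ≠ 0 := fun h => by simpa using congrArg (eval 0) h
  have heq := mul_left_cancel₀ h1X ((hz.symbolPoly_comp_C_mul_X w).symm.trans hprod)
  have heval := congrArg (eval (z k.succ w / z 0 w)) heq
  rw [eval_prod, Finset.prod_eq_zero (Finset.mem_univ k)] at heval
  · simp only [eval_sub, eval_one, eval_finsetSum, eval_mul, eval_C, eval_X, eval_pow] at heval
    exact (sub_eq_zero.1 heval).symm
  · simp [div_mul_div_comm, mul_comm (z 0 w),
      div_self (mul_ne_zero (hz.ne_zero k.succ w) (hz.ne_zero 0 w))]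

theorem IsOrderedSolution.norm_div_pow_le (hz : IsOrderedSolution a z) (w : ℂ) (k : Fin p) :
    (‖z 0 w‖ / ‖z k.succ w‖) ^ p ≤ ∑ m : Fin (p + 1), ‖a m‖ * m * ‖z 0 w‖ ^ ((m : ℕ) + 1) := by
  set t := z 0 w / z k.succ w with ht
  have ht0 : t ≠ 0 := div_ne_zero (hz.ne_zero 0 w) (hz.ne_zero _ w)
  have ht1 : ‖t‖ ≤ 1 := by
    rw [ht, norm_div]
    exact div_le_one_of_le₀ ((hz w).2 (Fin.zero_le _)) (norm_nonneg _)
  -- The powers of `t⁻¹ = z_k / z_0` in `sum_mul_geom_sum_eq_one` have exponents at most `p`, so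
  -- multiplying by `t ^ p` makes all of them bounded.
  have hpow : ∀ m : Fin (p + 1), ∀ i ∈ Finset.range m, ‖t ^ p * (t⁻¹ * t⁻¹ ^ i)‖ ≤ 1 :=
    fun m i hi => by
      have hip : i + 1 ≤ p := by have := Finset.mem_range.1 hi; omega
      rw [← pow_succ', inv_pow, ← pow_sub₀ t ht0 hip, norm_pow]
      exact pow_le_one₀ (norm_nonneg t) ht1
  have hone := hz.sum_mul_geom_sum_eq_one w k
  rw [← inv_div, ← ht] at hone
  calc (‖z 0 w‖ / ‖z k.succ w‖) ^ p = ‖t ^ p‖ := by rw [norm_pow, ht, norm_div]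
    _ = ‖∑ m : Fin (p + 1), a m * z 0 w ^ ((m : ℕ) + 1) *
          ∑ i ∈ Finset.range m, t ^ p * (t⁻¹ * t⁻¹ ^ i)‖ := by
      simp only [← Finset.mul_sum, mul_left_comm _ (t ^ p), hone, mul_one]
    _ ≤ ∑ m : Fin (p + 1), ‖a m * z 0 w ^ ((m : ℕ) + 1) *
          ∑ i ∈ Finset.range m, t ^ p * (t⁻¹ * t⁻¹ ^ i)‖ := norm_sum_le _ _
    _ ≤ ∑ m : Fin (p + 1), ‖a m‖ * m * ‖z 0 w‖ ^ ((m : ℕ) + 1) := by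
      refine Finset.sum_le_sum fun m _ => ?_
      rw [norm_mul, norm_mul, norm_pow, mul_right_comm _ (m : ℝ)]
      gcongr
      simpa using norm_sum_le_of_le _ (hpow m)

theorem IsOrderedSolution.tendsto_norm_div_norm (hz : IsOrderedSolution a z) (k : Fin p) :
    Tendsto (fun w => ‖z 0 w‖ / ‖z k.succ w‖) (cobounded ℂ) (𝓝 0) := by
  have hp : p ≠ 0 := by have := k.2; omega
  have hsum : Tendsto (fun w => ∑ m : Fin (p + 1), ‖a m‖ * m * ‖z 0 w‖ ^ ((m : ℕ) + 1))
      (cobounded ℂ) (𝓝 0) := by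
    have hterm : ∀ m : Fin (p + 1), Tendsto (fun w => ‖a m‖ * m * ‖z 0 w‖ ^ ((m : ℕ) + 1))
        (cobounded ℂ) (𝓝 0) := fun m => by
      simpa using (hz.tendsto_pow_zero (Nat.succ_pos m)).norm.const_mul (‖a m‖ * m)
    simpa using tendsto_finsetSum Finset.univ fun m _ => hterm m
  have hpow := squeeze_zero (fun w => by positivity) (fun w => hz.norm_div_pow_le w k) hsum
  have hroot := hpow.rpow_const (p := (p : ℝ)⁻¹) (.inr (by positivity))
  rw [Real.zero_rpow (by positivity)] at hroot
  exact hroot.congr fun w => Real.pow_rpow_inv_natCast (by positivity) hp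

theorem continuous_elim_zero {E : Type*} [TopologicalSpace E] [Zero E] {f : ℂ → E}
    (hf : Continuous f) (h0 : Tendsto f (cobounded ℂ) (𝓝 0)) :
    Continuous fun w : OnePoint ℂ => w.elim 0 f := by
  rw [Metric.cobounded_eq_cocompact, ← coclosedCompact_eq_cocompact] at h0
  exact (OnePoint.continuous_iff _).2 ⟨h0, hf⟩

theorem IsOrderedSolution.exists_norm_zero_le (hz : IsOrderedSolution a z) {K : Set (OnePoint ℂ)}
    (hK : IsCompact K) : ∃ B, ∀ w : ℂ, (w : OnePoint ℂ) ∈ K → ‖z 0 w‖ ≤ B := by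
  have hlim : Tendsto (fun w => ‖z 0 w‖) (cobounded ℂ) (𝓝 0) := by
    simpa using (hz.tendsto_pow_zero le_rfl).norm
  have hcont := continuous_elim_zero (hz.continuous_norm 0) hlim
  obtain ⟨B, hB⟩ := hK.bddAbove_image hcont.continuousOn
  exact ⟨B, fun w hw => hB ⟨w, hw, rfl⟩⟩

theorem IsOrderedSolution.exists_norm_div_norm_le (hz : IsOrderedSolution a z) (k : Fin p)
    {K : Set (OnePoint ℂ)} (hK : IsCompact K)
    (hlt : ∀ w : ℂ, (w : OnePoint ℂ) ∈ K → ‖z 0 w‖ < ‖z k.succ w‖) :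
    ∃ q, |q| < 1 ∧ ∀ w : ℂ, (w : OnePoint ℂ) ∈ K → ‖z 0 w‖ / ‖z k.succ w‖ ≤ q := by
  have hcont := continuous_elim_zero ((hz.continuous_norm 0).div (hz.continuous_norm k.succ)
    fun w => norm_ne_zero_iff.2 (hz.ne_zero k.succ w)) (hz.tendsto_norm_div_norm k)
  rcases K.eq_empty_or_nonempty with rfl | hne
  · exact ⟨0, by simp, by simp⟩
  obtain ⟨x, hx, hmax⟩ := hK.exists_isMaxOn hne hcont.continuousOn
  refine ⟨_, ?_, fun w hw => hmax hw⟩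
  induction x using OnePoint.rec with
  | infty => simp
  | coe w =>
    change |‖z 0 w‖ / ‖z k.succ w‖| < 1
    rw [abs_of_nonneg (by positivity)]
    exact (div_lt_one (norm_pos_iff.2 (hz.ne_zero k.succ w))).2 (hlt w hx)

end RootModuli

section RatioAsymptotics

variable {p : ℕ} {a : Fin (p + 1) → ℂ} {z : Fin (p + 1) → ℂ → ℂ}

theorem IsOrderedSolution.pow_mul_QPoly (hz : IsOrderedSolution a z) (w : ℂ) (n : ℕ) :
    z 0 w ^ n * (QPoly a n).eval w = PowerSeries.coeff n
      (geomSeries 1 * ∏ k : Fin p, geomSeries (z 0 w * (z k.succ w)⁻¹)) := by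
  have h := congrArg (PowerSeries.rescale (z 0 w)) (hz.mk_QPoly_eq_prod w)
  rw [PowerSeries.rescale_mk, map_prod, Fin.prod_univ_succ] at h
  simp only [rescale_geomSeries, mul_inv_cancel₀ (hz.ne_zero 0 w)] at h
  rw [← h, PowerSeries.coeff_mk]

theorem IsOrderedSolution.exists_tendstoUniformlyOn_pow_mul_QPoly (hz : IsOrderedSolution a z)
    {S : Set ℂ} {q : ℝ} (hq : |q| < 1) (hS : ∀ w ∈ S, ∀ k : Fin p, ‖z 0 w‖ / ‖z k.succ w‖ ≤ q) :
    ∃ L : ℂ → ℂ, (∀ w ∈ S, (2⁻¹ : ℝ) ^ p ≤ ‖L w‖) ∧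
      TendstoUniformlyOn (fun (n : ℕ) w => z 0 w ^ n * (QPoly a n).eval w) L atTop S := by
  have hx : ∀ w ∈ S, ∀ k ∈ Finset.univ, ‖z 0 w * (z (Fin.succ k) w)⁻¹‖ ≤ q := fun w hw k _ => by
    rw [← div_eq_mul_inv, norm_div]
    exact hS w hw k
  refine ⟨_, fun w hw => ?_,
    (tendstoUniformlyOn_coeff_geomSeries_one_mul_prod hq hx).congr
      (.of_forall fun n w _ => (hz.pow_mul_QPoly w n).symm)⟩
  simpa using inv_two_pow_le_norm_prod_one_sub_inv
    fun k hk => (hx w hw k hk).trans_lt ((le_abs_self q).trans_lt hq)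

theorem IsOrderedSolution.eventually_QPoly_ne_zero (hz : IsOrderedSolution a z)
    {S : Set ℂ} {q : ℝ} (hq : |q| < 1) (hS : ∀ w ∈ S, ∀ k : Fin p, ‖z 0 w‖ / ‖z k.succ w‖ ≤ q) :
    ∀ᶠ n : ℕ in atTop, ∀ w ∈ S, (QPoly a n).eval w ≠ 0 := by
  obtain ⟨L, hL, hlim⟩ := hz.exists_tendstoUniformlyOn_pow_mul_QPoly hq hS
  have hc : (0 : ℝ) < 2⁻¹ ^ p := by positivity
  filter_upwards [eventually_forall_half_le_norm hlim hc hL] with n hn w hw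
  exact right_ne_zero_of_mul (norm_pos_iff.1 ((half_pos hc).trans_le (hn w hw)))

theorem IsOrderedSolution.tendstoUniformlyOn_QPoly_div (hz : IsOrderedSolution a z)
    {S : Set ℂ} {q B : ℝ} (hq : |q| < 1)
    (hS : ∀ w ∈ S, ∀ k : Fin p, ‖z 0 w‖ / ‖z k.succ w‖ ≤ q) (hB : ∀ w ∈ S, ‖z 0 w‖ ≤ B) (j : ℕ) :
    TendstoUniformlyOn (fun (n : ℕ) w => (QPoly a (n - j)).eval w / (QPoly a n).eval w)
      (fun w => z 0 w ^ j) atTop S := by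
  obtain ⟨L, hL, hlim⟩ := hz.exists_tendstoUniformlyOn_pow_mul_QPoly hq hS
  have hone := tendstoUniformlyOn_div_one
    (fun u hu => (tendsto_sub_atTop_nat j).eventually (hlim u hu)) hlim (by positivity) hL
  have hBj : ∀ w ∈ S, ‖z 0 w ^ j‖ ≤ B ^ j := fun w hw => by
    rw [norm_pow]
    exact pow_le_pow_left₀ (norm_nonneg _) (hB w hw) j
  refine ((tendstoUniformlyOn_mul_of_norm_le hone hBj).congr ?_).congr_right fun w _ => mul_one _
  filter_upwards [eventually_ge_atTop j] with n hn w _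
  simp only
  rw [← mul_div_assoc, ← mul_assoc, ← pow_add, Nat.add_sub_cancel' hn, Nat.cast_sub hn,
    mul_div_mul_left _ _ (pow_ne_zero n (hz.ne_zero 0 w))]

theorem IsOrderedSolution.exists_norm_div_norm_le_of_disjoint (hp : 1 ≤ p)
    (hz : IsOrderedSolution a z) {K : Set (OnePoint ℂ)} (hK : IsCompact K)
    (hdisj : Disjoint K ((fun w : ℂ => (w : OnePoint ℂ)) '' Gamma z ⟨0, hp⟩)) :
    ∃ q, |q| < 1 ∧
      ∀ w : ℂ, (w : OnePoint ℂ) ∈ K → ∀ k : Fin p, ‖z 0 w‖ / ‖z k.succ w‖ ≤ q := by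
  obtain ⟨q, hq, hqK⟩ := hz.exists_norm_div_norm_le ⟨0, hp⟩ hK fun w hw =>
    ((hz w).2 (Fin.zero_le _)).lt_of_ne fun h => Set.disjoint_left.1 hdisj hw ⟨w, h, rfl⟩
  refine ⟨q, hq, fun w hw k => le_trans ?_ (hqK w hw)⟩
  exact div_le_div_of_nonneg_left (norm_nonneg _) (norm_pos_iff.2 (hz.ne_zero _ w))
    ((hz w).2 (Fin.succ_le_succ_iff.2 (Fin.mk_le_of_le_val (Nat.zero_le _))))

theorem tendstoUniformlyOn_extendByZero {ι : Type*} {l : Filter ι} {F : ι → ℂ → ℂ} {f : ℂ → ℂ}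
    {K : Set (OnePoint ℂ)}
    (h : TendstoUniformlyOn F f l {w : ℂ | (w : OnePoint ℂ) ∈ K}) :
    TendstoUniformlyOn (fun i => extendByZero (F i)) (extendByZero f) l K := by
  intro u hu
  filter_upwards [h u hu] with i hi x hx
  induction x using OnePoint.rec with
  | infty => exact refl_mem_uniformity hu
  | coe w => exact hi w hx

theorem IsOrderedSolution.ratio_asymptotics (hp : 1 ≤ p) (hz : IsOrderedSolution a z)
    {K : Set (OnePoint ℂ)} (hK : IsCompact K)
    (hdisj : Disjoint K ((fun w : ℂ => (w : OnePoint ℂ)) '' Gamma z ⟨0, hp⟩)) (j : ℕ) :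
    (∀ᶠ n : ℕ in atTop, ∀ w : ℂ, (w : OnePoint ℂ) ∈ K → (QPoly a n).eval w ≠ 0) ∧
      TendstoUniformlyOn
        (fun n : ℕ => extendByZero fun w => (QPoly a (n - j)).eval w / (QPoly a n).eval w)
        (extendByZero fun w => z 0 w ^ j) atTop K := by
  obtain ⟨B, hB⟩ := hz.exists_norm_zero_le hK
  obtain ⟨q, hq, hqK⟩ := hz.exists_norm_div_norm_le_of_disjoint hp hK hdisj
  exact ⟨hz.eventually_QPoly_ne_zero (S := {w : ℂ | (w : OnePoint ℂ) ∈ K}) hq hqK,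
    tendstoUniformlyOn_extendByZero (hz.tendstoUniformlyOn_QPoly_div hq hqK hB j)⟩

end RatioAsymptotics

end ToeplitzRec

theorem mainTheorem1 (p : ℕ) (hp : 1 ≤ p) (a : Fin (p + 1) → ℂ) (ha : a (Fin.last p) ≠ 0)
    (z : Fin (p + 1) → ℂ → ℂ) (hz : IsOrderedSolution a z) :
    -- i) equality where the resolvent exists, and equality of the Laurent expansions at infinity
    (∀ j ∈ Finset.Icc 1 p,
      (∀ w ∈ resolventSet ℂ (toeplitzOp a), resolventFun a j w = z 0 w ^ j) ∧
      ∃ c : ℕ → ℂ, HasLaurentAtInfty (resolventFun a j) c ∧ HasLaurentAtInfty (fun w => z 0 w ^ j) c) ∧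
    -- ii) multiple orthogonality
    (∀ n : ℕ, ∀ j ∈ Finset.Icc 1 p, ∀ k < stair p n j, LFun a j (X ^ k * QPoly a n) = 0) ∧
    -- iii) type II Hermite–Padé approximation
    (∀ n : ℕ, IsTypeIIHermitePade p (fun j w => z 0 w ^ j) (stair p n) (QPoly a n)
      (fun j => QPoly a (n - j))) ∧
    -- iv) ratio asymptotics; the functions involved vanish at infinity, so that extending them by
    -- zero is extending them continuously, and the denominators have no zeros on `K` eventually
    (∀ j ∈ Finset.Icc 1 p,
      Tendsto (fun w => z 0 w ^ j) (cobounded ℂ) (𝓝 0) ∧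
      (∀ n : ℕ, Tendsto (fun w => (QPoly a (n - j)).eval w / (QPoly a n).eval w) (cobounded ℂ) (𝓝 0)) ∧
      ∀ K : Set (OnePoint ℂ), IsCompact K →
        Disjoint K ((fun w : ℂ => (w : OnePoint ℂ)) '' Gamma z ⟨0, hp⟩) →
        (∀ᶠ n : ℕ in atTop, ∀ w : ℂ, (w : OnePoint ℂ) ∈ K → (QPoly a n).eval w ≠ 0) ∧
        TendstoUniformlyOn
          (fun n : ℕ => extendByZero fun w => (QPoly a (n - j)).eval w / (QPoly a n).eval w)
          (extendByZero fun w => z 0 w ^ j) atTop K) := by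
  refine ⟨fun j hj => ?_, fun n j hj k hk => LFun_X_pow_mul_QPoly a hj hk,
    hz.isTypeIIHermitePade hp, fun j hj => ?_⟩
  all_goals have hj1 : 1 ≤ j := (Finset.mem_Icc.1 hj).1
  · exact ⟨fun w hw => hz.resolventFun_eq hw hj1, _, hasLaurentAtInfty_resolventFun a j,
      hz.hasLaurentAtInfty_pow hj1⟩
  · exact ⟨hz.tendsto_pow_zero hj1, tendsto_QPoly_div_zero a hj1,
      fun K hK hdisj => hz.ratio_asymptotics hp hK hdisj j⟩
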